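/- \textbf{Setting.} A Bayesian game with $n\ge 1$ players $N=\{1,\dots,n\}$ consists of finite type sets $\Theta_i$ ($i\in N$), a prior probability distribution $\rho$ on $\Theta=\Theta_1\times\dots\times\Theta_n$, a nonempty finite action set $A_i^{\theta_i}$ for each $i\in N$ and $\theta_i\in\Theta_i$, and utility functions $v_i\colon A\to\mathbb{R}_{\ge 0}$ for $i \in N$, where $A=A_1\times\dots\times A_n$ and $A_i=\bigcup_{\theta_i\in\Theta_i}A_i^{\theta_i}$. Put $E=\bigcup_{i\in N} A_i$. The social welfare of $a\in A$ is $v_{\mathrm{SW}}(a)=f(\{a_1,\dots,a_n\})$, where $f\colon 2^E\to\mathbb{R}_{\ge 0}$ is monotone ($f(X)\le f(Y)$ for $X\subseteq Y$) and submodular ($f(X\cup\{u\})-f(X)\ge f(Y\cup\{u\})-f(Y)$ for $X\subseteq Y\subseteq E$ and $u\in E\setminus Y$). The game is a \emph{Bayesian valid utility game} if, for all $a\in A$ and all $i\in N$, $$v_{\mathrm{SW}}(a)\ge\sum_{j\in N}v_j(a)\qquad\text{and}\qquad v_i(a)\ge v_{\mathrm{SW}}(a)-f(\{a_j : j\in N,\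 j\ne i\}),$$ and it is a \emph{Bayesian basic utility game} if in addition the second inequality is always an equality. Let $A^\theta=A_1^{\theta_1}\times\dots\times A_n^{\theta_n}$ for $\theta \in \Theta$, and let $S$ be the set of strategy profiles $s=(s_1,\dots,s_n)$, where $s_i$ assigns to every $\theta_i\in\Theta_i$ an action $s_i(\theta_i)\in A_i^{\theta_i}$; write $s(\theta)=(s_1(\theta_1),\dots,s_n(\theta_n))$. If $\mathbb{E}_{\theta\sim\rho}[\max_{a\in A^\theta}v_{\mathrm{SW}}(a)]>0$, the \emph{strategy representability gap} of the game is $$\frac{\max_{s\in S}\mathbb{E}_{\theta\sim\rho}\left[v_{\mathrm{SW}}(s(\theta))\right]}{\mathbb{E}_{\theta\sim\rho}\left[\max_{a\in A^\theta}v_{\mathrm{SW}}(a)\right]}.$$ \textbf{Theorem.} Assume that $\sqrt n$ is an integer. For every Bayesian valid or basic utility game with $n$ players and positive expected optimal welfare $\mathbb{E}_{\theta\sim\rho}[\max_{a\in A^\theta}v_{\mathrm{SW}}(a)]$, with an arbitrary (possibly correlated) prior $\rho$, the strategy representability gap is at least $$\frac{1}{\left(2+\frac{1}{1-1/e}\right)\sqrt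 n}.$$ -/

import Mathlib

/-- A set function on a finite ground set `E` is submodular if it has diminishing marginal
contributions. -/
def SubmodularSetFun {E : Type*} [DecidableEq E] (f : Finset E → ℝ) : Prop :=
  ∀ X Y : Finset E, X ⊆ Y → ∀ u : E, u ∉ Y →
    f (insert u Y) - f Y ≤ f (insert u X) - f X

/-- A Bayesian game with `n` players, finite type sets `Θ i`, and actions taken from a finite
set `E`.  The set of actions available to player `i` depends on their own type; the action sets
of different players or types may, but need not, be disjoint.  The prior over type profiles is
an arbitrary probability distribution, so types may be correlated.  The utility of each player
is a nonnegative function of the action profile `a ∈ ∏ j, ⋃ t, act j t`.  The social welfare is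
represented by the set function `f`. -/
structure BayesianGame {n : ℕ} (Θ : Fin n → Type*) [∀ i, Fintype (Θ i)]
    (E : Type*) [Fintype E] [DecidableEq E] where
  /-- the actions available to a player with a given type -/
  act : (i : Fin n) → Θ i → Finset E
  act_nonempty : ∀ i t, (act i t).Nonempty
  /-- the common prior distribution over type profiles -/
  prior : ((i : Fin n) → Θ i) → ℝ
  prior_mem : prior ∈ stdSimplex ℝ ((i : Fin n) → Θ i)
  /-- the utility functions of the players -/
  utility : Fin n → ((j : Fin n) → {e : E // ∃ t, e ∈ act j t}) → ℝ
  utility_nonneg : ∀ i a, 0 ≤ utility i a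
  /-- the set function that represents the social welfare -/
  f : Finset E → ℝ

namespace BayesianGame

variable {n : ℕ} {Θ : Fin n → Type*} [∀ i, Fintype (Θ i)] {E : Type*} [Fintype E] [DecidableEq E]

/-- Action profiles of the whole game: player `j` plays some action from the union of their
action sets over all their types. -/
abbrev Profile (G : BayesianGame Θ E) : Type _ :=
  (j : Fin n) → {e : E // ∃ t, e ∈ G.act j t}

/-- Action profiles available under the type profile `θ`. -/
abbrev ProfileAt (G : BayesianGame Θ E) (θ : (i : Fin n) → Θ i) : Type _ :=
  (j : Fin n) → {e : E // e ∈ G.act j (θ j)}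

/-- Strategy profiles: each player's action is a function of their own type only. -/
abbrev StrategyProfile (G : BayesianGame Θ E) : Type _ :=
  (j : Fin n) → (t : Θ j) → {e : E // e ∈ G.act j t}

/-- The social welfare `f {a₁, …, aₙ}` of the actions `a₁, …, aₙ`. -/
def welfare (G : BayesianGame Θ E) (a : Fin n → E) : ℝ :=
  G.f (Finset.univ.image a)

/-- The social welfare when player `i` selects nothing and the others play according to `a`. -/
def welfareWithout (G : BayesianGame Θ E) (i : Fin n) (a : Fin n → E) : ℝ :=
  G.f ((Finset.univ.erase i).image a)

/-- Bayesian valid utility games. -/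
structure IsValid (G : BayesianGame Θ E) : Prop where
  nonneg : ∀ X, 0 ≤ G.f X
  monotone : Monotone G.f
  submodular : SubmodularSetFun G.f
  total_utility : ∀ a : G.Profile, ∑ i, G.utility i a ≤ G.welfare (fun j => a j)
  marginal_contribution : ∀ (a : G.Profile) (i : Fin n),
    G.welfare (fun j => a j) - G.welfareWithout i (fun j => a j) ≤ G.utility i a

/-- Bayesian basic utility games: the marginal contribution condition holds with equality. -/
structure IsBasic (G : BayesianGame Θ E) : Prop extends IsValid G where
  marginal_contribution_eq : ∀ (a : G.Profile) (i : Fin n),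
    G.utility i a = G.welfare (fun j => a j) - G.welfareWithout i (fun j => a j)

/-- The expected social welfare of a strategy profile. -/
noncomputable def strategyWelfare (G : BayesianGame Θ E) (s : G.StrategyProfile) : ℝ :=
  ∑ θ, G.prior θ * G.welfare (fun j => s j (θ j))

/-- The best expected social welfare of a strategy profile (a maximum over a nonempty finite
set). -/
noncomputable def strWelfare (G : BayesianGame Θ E) : ℝ :=
  ⨆ s : G.StrategyProfile, G.strategyWelfare s

/-- The expected optimal social welfare, where the action profile is optimized separately for
each type profile (a maximum over a nonempty finite set). -/
noncomputable def optWelfare (G : BayesianGame Θ E) : ℝ :=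
  ∑ θ, G.prior θ * ⨆ a : G.ProfileAt θ, G.welfare (fun j => a j)

/-- The strategy representability gap. -/
noncomputable def srGap (G : BayesianGame Θ E) : ℝ :=
  G.strWelfare / G.optWelfare

end BayesianGame

/-!
The bound holds with the better constant `2 k + 1`, where `k = √n`: the expected optimal welfare
is at most `2 k + 1` times the best expected welfare of a strategy profile. Only the set function
matters, and no randomization is needed.

Call `f (insert u X) - f X` the marginal of `u` over `X`. For every player and type, choose `k`
available actions greedily (`exists_greedy`); let `D` be the set of the chosen actions. The
marginals picked up by the greedy choice decrease, so every available action `u` has a marginal of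
at most `f D / k` over `D`. The `c`-th greedy actions of all the players and types form a strategy
profile `d c`. Let `s` be a strategy profile of maximal expected welfare.

Fix a type profile `θ`. Adding the optimal actions to the union of the `n` sets `D` shows that
the optimal welfare is at most `∑ c, welfare (d c)`, by subadditivity, plus the sum over the players
of the marginals of the optimal actions over their own set `D`. The latter are at most `f D / k`,
and `f D` is at most the welfare of `s` plus the marginals over `s` of the elements of `D`
(`card_mul_welfare_le`). Taking expectations,

* every `d c` has an expected welfare of at most that of `s`, which contributes `k` times the best
  welfare;
* the `n` terms `welfare s / k` contribute `n / k = k` times the best welfare;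
* the marginals over `s` of the actions of `d c` are at most the gains of unilateral deviations over
  the profile without the deviating player. Since `s` is optimal, they are at most the marginal
  contributions of the players under `s`, and these sum to at most the welfare of `s`
  (`sum_expected_marginal_le`). Averaging over `c` contributes the best welfare once.
-/

/-! ### Monotone submodular set functions -/

section SetFunction

variable {E ι : Type*} [DecidableEq E] {f : Finset E → ℝ}

/-- For monotone functions, diminishing marginal contributions hold also for elements of the
larger set. -/
lemma SubmodularSetFun.marginal_anti (hs : SubmodularSetFun f) (hm : Monotone f)
    {X Y : Finset E} (hXY : X ⊆ Y) (u : E) :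
    f (insert u Y) - f Y ≤ f (insert u X) - f X := by
  by_cases hu : u ∈ Y
  · rw [Finset.insert_eq_of_mem hu, sub_self, sub_nonneg]
    exact hm (Finset.subset_insert u X)
  · exact hs X Y hXY u hu

/-- The increase of `f` on adding a family of elements to `X` is at most the sum of their
marginals, each taken over an arbitrary subset of `X`. -/
lemma SubmodularSetFun.union_image_le (hs : SubmodularSetFun f) (hm : Monotone f)
    (T : Finset ι) (a : ι → E) (X : Finset E) (Y : ι → Finset E) (hY : ∀ i ∈ T, Y i ⊆ X) :
    f (X ∪ T.image a) ≤ f X + ∑ i ∈ T, (f (insert (a i) (Y i)) - f (Y i)) := by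
  classical
  induction T using Finset.induction_on with
  | empty => simp
  | insert i T hi ih =>
    rw [Finset.image_insert, Finset.union_insert, Finset.sum_insert hi]
    have h1 := ih fun j hj => hY j (Finset.mem_insert_of_mem hj)
    have h2 := hs.marginal_anti hm
      ((hY i (Finset.mem_insert_self i T)).trans Finset.subset_union_left :
        Y i ⊆ X ∪ T.image a) (a i)
    linarith

lemma SubmodularSetFun.union_le (hs : SubmodularSetFun f) (hm : Monotone f)
    (h0 : ∀ X, 0 ≤ f X) (X Y : Finset E) : f (X ∪ Y) ≤ f X + f Y := by
  induction Y using Finset.induction_on with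
  | empty => simpa using h0 ∅
  | insert u Y _ ih =>
    rw [Finset.union_insert]
    have := hs.marginal_anti hm (Finset.subset_union_right : Y ⊆ X ∪ Y) u
    linarith

/-- Nonnegative monotone submodular functions are subadditive over finite unions. The index type is
nonempty because `f ∅` may be positive. -/
lemma SubmodularSetFun.biUnion_le (hs : SubmodularSetFun f) (hm : Monotone f)
    (h0 : ∀ X, 0 ≤ f X) {T : Finset ι} (hT : T.Nonempty) (S : ι → Finset E) :
    f (T.biUnion S) ≤ ∑ i ∈ T, f (S i) := by
  classical
  induction hT using Finset.Nonempty.cons_induction with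
  | singleton i => simp
  | cons i T hi hT ih =>
    rw [Finset.cons_eq_insert, Finset.biUnion_insert, Finset.sum_insert hi]
    linarith [hs.union_le hm h0 (S i) (T.biUnion S)]

/-- The greedy choice of `k` elements of `A` leaves every element of `A` with a marginal of at most
a `k`-th of the value of the chosen set. -/
lemma SubmodularSetFun.exists_greedy (hs : SubmodularSetFun f) (hm : Monotone f)
    (h0 : ∀ X, 0 ≤ f X) {A : Finset E} (hA : A.Nonempty) (k : ℕ) :
    ∃ d : Fin k → {e : E // e ∈ A}, ∀ u ∈ A,
      k * (f (insert u (Finset.univ.image fun c => (d c : E))) -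
        f (Finset.univ.image fun c => (d c : E))) ≤ f (Finset.univ.image fun c => (d c : E)) := by
  induction k with
  | zero => exact ⟨Fin.elim0, fun u _ => by simpa using h0 _⟩
  | succ k ih =>
    obtain ⟨d, hd⟩ := ih
    set D := Finset.univ.image fun c => (d c : E) with hD
    obtain ⟨w, hw, hmax⟩ := A.exists_max_image (fun u => f (insert u D)) hA
    refine ⟨Fin.cons ⟨w, hw⟩ d, fun u hu => ?_⟩
    have him : (Finset.univ.image fun c : Fin (k + 1) =>
        ((Fin.cons ⟨w, hw⟩ d : Fin (k + 1) → {e : E // e ∈ A}) c : E)) = insert w D := by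
      ext x
      simp [hD, Fin.exists_fin_succ, eq_comm]
    rw [him]
    push_cast
    -- The marginal of `u` over `insert w D` is at most that of `w` over `D`, which is at most
    -- `f D / k`.
    have h1 := hs.marginal_anti hm (Finset.subset_insert w D) u
    have h2 := hmax u hu
    have h3 := hd w hw
    have h4 : ((k : ℝ) + 1) * (f (insert u (insert w D)) - f (insert w D)) ≤
        (k + 1) * (f (insert w D) - f D) :=
      mul_le_mul_of_nonneg_left (by linarith) (by positivity)
    linarith

end SetFunction

/-! ### Expected welfare of strategy profiles -/

namespace BayesianGame

variable {n : ℕ} {Θ : Fin n → Type*} [∀ i, Fintype (Θ i)] {E : Type*} [Fintype E] [DecidableEq E]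
  {G : BayesianGame Θ E}

instance : Nonempty G.StrategyProfile :=
  ⟨fun j t => ⟨_, (G.act_nonempty j t).choose_spec⟩⟩

instance (θ : (i : Fin n) → Θ i) : Nonempty (G.ProfileAt θ) :=
  ⟨fun j => ⟨_, (G.act_nonempty j (θ j)).choose_spec⟩⟩

lemma strategyWelfare_le_strWelfare (s : G.StrategyProfile) :
    G.strategyWelfare s ≤ G.strWelfare :=
  le_ciSup (f := G.strategyWelfare) (Set.finite_range _).bddAbove s

/-- The marginal contributions of the players sum to at most the welfare. -/
lemma IsValid.sum_marginal_le (hG : G.IsValid) (s : G.StrategyProfile) (θ : (i : Fin n) → Θ i) :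
    ∑ i, (G.welfare (fun j => s j (θ j)) - G.welfareWithout i (fun j => s j (θ j))) ≤
      G.welfare (fun j => s j (θ j)) := by
  let a : G.Profile := fun j => ⟨s j (θ j), θ j, (s j (θ j)).2⟩
  exact (Finset.sum_le_sum fun i _ => hG.marginal_contribution a i).trans (hG.total_utility a)

/-- If `s` maximizes the expected welfare, then the actions of any other strategy profile have
expected marginals over the actions of `s` that sum to at most the expected welfare of `s`. -/
lemma IsValid.sum_expected_marginal_le (hG : G.IsValid) {s : G.StrategyProfile}
    (hs : G.strategyWelfare s = G.strWelfare) (d : G.StrategyProfile) :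
    ∑ i, ∑ θ, G.prior θ * (G.f (insert (d i (θ i) : E)
      (Finset.univ.image fun j => (s j (θ j) : E))) - G.welfare fun j => s j (θ j)) ≤
      G.strWelfare := by
  calc
    _ ≤ ∑ i, ∑ θ, G.prior θ * (G.welfare (fun j => s j (θ j)) -
          G.welfareWithout i (fun j => s j (θ j))) := by
      refine Finset.sum_le_sum fun i _ => ?_
      have hdev := strategyWelfare_le_strWelfare (Function.update s i (d i))
      rw [← hs] at hdev
      have hpt : ∀ θ, G.prior θ * (G.f (insert (d i (θ i) : E)
          (Finset.univ.image fun j => (s j (θ j) : E))) - G.welfare fun j => s j (θ j)) ≤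
          G.prior θ * G.welfare (fun j => Function.update s i (d i) j (θ j)) -
          G.prior θ * G.welfareWithout i (fun j => s j (θ j)) := by
        intro θ
        rw [← mul_sub]
        refine mul_le_mul_of_nonneg_left ?_ (G.prior_mem.1 θ)
        have himg : (Finset.univ.image fun j => (Function.update s i (d i) j (θ j) : E)) =
            insert (d i (θ i) : E)
              ((Finset.univ.erase i).image fun j => (s j (θ j) : E)) := by
          rw [← Finset.insert_erase (Finset.mem_univ i), Finset.image_insert]
          simp only [Function.update_self, Finset.erase_insert_eq_erase, Finset.erase_idem]
          congr 1
          refine Finset.image_congr fun j hj => ?_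
          have hj : j ≠ i := by simpa using hj
          simp [Function.update_of_ne hj]
        unfold welfare welfareWithout
        rw [himg]
        exact hG.submodular.marginal_anti hG.monotone
          (Finset.image_subset_image (Finset.erase_subset i _)) _
      refine (Finset.sum_le_sum fun θ _ => hpt θ).trans ?_
      simp only [mul_sub, Finset.sum_sub_distrib]
      exact sub_le_sub_right hdev _
    _ ≤ G.strWelfare := by
      rw [Finset.sum_comm, ← hs]
      refine Finset.sum_le_sum fun θ _ => ?_
      rw [← Finset.mul_sum]
      exact mul_le_mul_of_nonneg_left (hG.sum_marginal_le s θ) (G.prior_mem.1 θ)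

/-- The comparison of the welfare of an action profile with the welfare of `k` greedy strategy
profiles `d c` and a further strategy profile `s`, for a fixed type profile. -/
lemma IsValid.card_mul_welfare_le (hG : G.IsValid) {k : ℕ} (hk : 0 < k)
    (d : Fin k → G.StrategyProfile)
    (hd : ∀ i t, ∀ u ∈ G.act i t, k * (G.f (insert u (Finset.univ.image fun c => (d c i t : E))) -
      G.f (Finset.univ.image fun c => (d c i t : E))) ≤
        G.f (Finset.univ.image fun c => (d c i t : E)))
    (s : G.StrategyProfile) (θ : (i : Fin n) → Θ i) (a : G.ProfileAt θ) :
    k * G.welfare (fun j => a j) ≤ k * ∑ c, G.welfare (fun j => d c j (θ j)) +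
      n * G.welfare (fun j => s j (θ j)) +
      ∑ c, ∑ i, (G.f (insert (d c i (θ i) : E) (Finset.univ.image fun j => (s j (θ j) : E))) -
        G.welfare fun j => s j (θ j)) := by
  set R := Finset.univ.image fun j => (s j (θ j) : E)
  change _ ≤ _ + n * G.f R + ∑ c, ∑ i, (G.f (insert (d c i (θ i) : E) R) - G.f R)
  set D : Fin n → Finset E := fun i => Finset.univ.image fun c => (d c i (θ i) : E) with hD
  set U : Finset E := Finset.univ.biUnion fun c =>
    Finset.univ.image fun j => (d c j (θ j) : E) with hU
  have : NeZero k := ⟨hk.ne'⟩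
  have hDU : ∀ i, D i ⊆ U := by
    intro i x
    simp only [hD, hU, Finset.mem_image, Finset.mem_biUnion, Finset.mem_univ, true_and]
    rintro ⟨c, hc⟩
    exact ⟨c, i, hc⟩
  have hUle : G.f U ≤ ∑ c, G.welfare (fun j => d c j (θ j)) :=
    hG.submodular.biUnion_le hG.monotone hG.nonneg Finset.univ_nonempty _
  have ha : G.welfare (fun j => a j) ≤
      G.f U + ∑ i, (G.f (insert (a i : E) (D i)) - G.f (D i)) :=
    (hG.monotone Finset.subset_union_right).trans
      (hG.submodular.union_image_le hG.monotone Finset.univ (fun j => (a j : E)) U D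
        fun i _ => hDU i)
  have hi : ∀ i, k * (G.f (insert (a i : E) (D i)) - G.f (D i)) ≤
      G.f R + ∑ c, (G.f (insert (d c i (θ i) : E) R) - G.f R) := fun i =>
    (hd i (θ i) _ (a i).2).trans <| (hG.monotone Finset.subset_union_right).trans
      (hG.submodular.union_image_le hG.monotone Finset.univ (fun c => (d c i (θ i) : E)) R
        (fun _ => R) fun _ _ => subset_rfl)
  have hsum := Finset.sum_le_sum fun i (_ : i ∈ Finset.univ) => hi i
  rw [← Finset.mul_sum, Finset.sum_add_distrib, Finset.sum_comm] at hsum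
  simp only [Finset.sum_const, Finset.card_univ, Fintype.card_fin, nsmul_eq_mul] at hsum
  have hk' : (0 : ℝ) ≤ k := k.cast_nonneg
  nlinarith [mul_le_mul_of_nonneg_left ha hk', mul_le_mul_of_nonneg_left hUle hk']

/-- The expected optimal welfare is at most `k + n / k + 1` times the best expected welfare of a
strategy profile, for every positive integer `k`. -/
theorem IsValid.mul_optWelfare_le (hG : G.IsValid) {k : ℕ} (hk : 0 < k) :
    k * G.optWelfare ≤ (k * k + n + k) * G.strWelfare := by
  obtain ⟨s, hs⟩ := exists_eq_ciSup_of_finite (f := G.strategyWelfare)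
  change G.strategyWelfare s = G.strWelfare at hs
  choose d' hd using fun i t =>
    hG.submodular.exists_greedy hG.monotone hG.nonneg (G.act_nonempty i t) k
  let d : Fin k → G.StrategyProfile := fun c i t => d' i t c
  have hpt : ∀ θ, k * (G.prior θ * ⨆ a : G.ProfileAt θ, G.welfare (fun j => a j)) ≤
      k * ∑ c, G.prior θ * G.welfare (fun j => d c j (θ j)) +
      n * (G.prior θ * G.welfare (fun j => s j (θ j))) +
      ∑ c, ∑ i, G.prior θ * (G.f (insert (d c i (θ i) : E)
        (Finset.univ.image fun j => (s j (θ j) : E))) - G.welfare fun j => s j (θ j)) := by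
    intro θ
    obtain ⟨a, ha⟩ := exists_eq_ciSup_of_finite
      (f := fun a : G.ProfileAt θ => G.welfare (fun j => a j))
    rw [← ha]
    have h := mul_le_mul_of_nonneg_left (hG.card_mul_welfare_le hk d hd s θ a) (G.prior_mem.1 θ)
    simp only [← Finset.mul_sum]
    linarith
  have hsum := Finset.sum_le_sum fun θ (_ : θ ∈ Finset.univ) => hpt θ
  rw [← Finset.mul_sum, Finset.sum_add_distrib, Finset.sum_add_distrib, ← Finset.mul_sum,
    ← Finset.mul_sum, Finset.sum_comm,
    Finset.sum_comm (t := (Finset.univ : Finset (Fin k)))] at hsum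
  -- In the last sum, the expectation is also moved inside the sum over the players.
  rw [Finset.sum_congr rfl fun c (_ : c ∈ Finset.univ) => Finset.sum_comm
    (f := fun θ i => G.prior θ * (G.f (insert (d c i (θ i) : E)
      (Finset.univ.image fun j => (s j (θ j) : E))) - G.welfare fun j => s j (θ j)))] at hsum
  have h1 : ∑ c, G.strategyWelfare (d c) ≤ k * G.strWelfare := by
    simpa using Finset.sum_le_sum fun c (_ : c ∈ Finset.univ) =>
      strategyWelfare_le_strWelfare (d c)
  have h2 : ∑ c, ∑ i, ∑ θ, G.prior θ * (G.f (insert (d c i (θ i) : E)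
      (Finset.univ.image fun j => (s j (θ j) : E))) - G.welfare fun j => s j (θ j)) ≤
      k * G.strWelfare := by
    simpa using Finset.sum_le_sum fun c (_ : c ∈ Finset.univ) =>
      hG.sum_expected_marginal_le hs (d c)
  have h3 := mul_le_mul_of_nonneg_left h1 (k.cast_nonneg : (0 : ℝ) ≤ k)
  rw [← hs] at h2 h3 ⊢
  unfold strategyWelfare optWelfare at *
  linarith

end BayesianGame

theorem mainTheorem1 {n : ℕ} (hn : 0 < n) (hsq : IsSquare n)
    {Θ : Fin n → Type*} [∀ i, Fintype (Θ i)] {E : Type*} [Fintype E] [DecidableEq E]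
    (G : BayesianGame Θ E) (hG : G.IsValid ∨ G.IsBasic) (hopt : 0 < G.optWelfare) :
    1 / ((2 + 1 / (1 - 1 / Real.exp 1)) * √(n : ℝ)) ≤ G.srGap := by
  have hV : G.IsValid := hG.elim id fun h => h.toIsValid
  obtain ⟨k, rfl⟩ := hsq
  have hk : 0 < k := Nat.pos_of_mul_pos_right hn
  have hk1 : (1 : ℝ) ≤ k := by exact_mod_cast hk
  rw [Nat.cast_mul, Real.sqrt_mul_self (by positivity)]
  have hmain := hV.mul_optWelfare_le hk
  push_cast at hmain
  have hle : G.optWelfare ≤ (2 * k + 1) * G.strWelfare :=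
    le_of_mul_le_mul_left (by linarith) (by positivity : (0 : ℝ) < k)
  have hstr : 0 ≤ G.strWelfare := by
    by_contra! h
    nlinarith [mul_neg_of_pos_of_neg (by positivity : (0 : ℝ) < 2 * k + 1) h]
  have he : 1 ≤ 1 / (1 - 1 / Real.exp 1) := by
    have h1 : 1 / Real.exp 1 < 1 := by
      rw [div_lt_one (Real.exp_pos 1)]
      exact Real.one_lt_exp_iff.2 one_pos
    rw [le_div_iff₀ (by linarith)]
    linarith [one_div_pos.2 (Real.exp_pos 1)]
  have hc : (2 * k + 1 : ℝ) ≤ (2 + 1 / (1 - 1 / Real.exp 1)) * k := by nlinarith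
  have hcpos : 0 < (2 + 1 / (1 - 1 / Real.exp 1)) * (k : ℝ) := by linarith
  rw [BayesianGame.srGap, div_le_div_iff₀ hcpos hopt, one_mul, mul_comm G.strWelfare]
  exact hle.trans (mul_le_mul_of_nonneg_right hc hstr)
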